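/- Let $L_{2e}^n$ be the space of (classes of) measurable $f:\mathbb{R}_+\to\mathbb{R}^n$ whose truncations $P_Tf$ ($=f(t)$ for $t\le T$, $0$ otherwise) lie in $L_2$ for all $T\ge 0$, and let $\ell_{2e}^n$ be the space of all sequences $f:\mathbb{Z}_+\to\mathbb{R}^n$, each with the topology of the seminorms $\|f\|_T=\|P_Tf\|_2$. Let $D_T$ be the shift, $(D_Tf)(t)=0$ for $t<T$ and $f(t-T)$ otherwise. Denote by $\mathrm{LTI}(\mathcal X,\mathcal Z)$ the set of continuous linear maps $A:\mathcal X\to\mathcal Z$ that are causal ($P_TAP_T=P_TA$ for all $T\ge 0$) and time-invariant ($D_TA=AD_T$ for all $T>0$). The space of continuous linear maps $\mathcal X\to\mathcal Z$ is given the topology generated by the open balls of all $\|A\|_T=\|P_TA\|_{L_2\to L_2}$ (in discrete time, $\|P_TA\|_{\ell_2\to\ell_2}$). Let $\mathcal Y=L_{2e}^{n_y}$ and $\mathcal U=L_{2e}^{n_u}$, or $\mathcal Y=\ell_{2e}^{n_y}$ and $\mathcal U=\ell_{2e}^{n_u}$. Let $G\in\mathrm{LTI}(\mathcal U,\mathcal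 Y)$, and let $S\subset\mathrm{LTI}(\mathcal Y,\mathcal U)$ be a set that is - inert with respect to $G$: for every $K\in S$, in the case of $L_{2e}$ the impulse response matrix of $GK$ is a function with entries in $L_{\infty e}$, that is, $GK$ is the convolution $(GKf)(t)=\int_0^t a(t-s)f(s)\,ds$ with a measurable matrix function $a$ that is essentially bounded on every $[0,T]$; in the case of $\ell_{2e}$ the value at time $0$ of the impulse response matrix of $GK$ has spectral radius less than $1$; - closed; - homogeneous: $\alpha K\in S$ for all $K\in S$ and $\alpha\in\mathbb{R}$. Then $I-GK$ is invertible, with continuous inverse, for every $K\in S$, so that $h(K)=-K(I-GK)^{-1}$ is defined on $S$. If $h(S)=T$, where $T$ is a star-shaped set of continuous linear maps $\mathcal Y\to\mathcal U$ (that is, $\alpha v\in T$ for all $v\in T$ and $\alpha\in[0,1]$), then $T=S$. -/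

import Mathlib

open MeasureTheory Set Topology
open scoped ENNReal NNReal

noncomputable section

/-! Notions that make sense in any real (topological) vector space. -/

/-- `S` is homogeneous: it is stable under multiplication by every real scalar. -/
def IsHomogeneous {V : Type*} [AddCommGroup V] [Module ℝ V] (S : Set V) : Prop :=
  ∀ v ∈ S, ∀ α : ℝ, α • v ∈ S

/-- `T` is star-shaped (about the origin). -/
def IsStarShaped {V : Type*} [AddCommGroup V] [Module ℝ V] (T : Set V) : Prop :=
  ∀ v ∈ T, ∀ α ∈ Icc (0 : ℝ) 1, α • v ∈ T

/-- The map `h(K) = -K (I - G K)⁻¹`, where the inverse is taken in the ring of continuous linear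
endomorphisms of `Y`. (It is meant for those `K` for which `I - G K` is invertible;
`Ring.inverse` is `0` on non-units.) -/
def hMap {U Y : Type*} [AddCommGroup U] [Module ℝ U] [TopologicalSpace U]
    [IsTopologicalAddGroup U] [AddCommGroup Y] [Module ℝ Y] [TopologicalSpace Y]
    [IsTopologicalAddGroup Y] (G : U →L[ℝ] Y) (K : Y →L[ℝ] U) : Y →L[ℝ] U :=
  -(K ∘L Ring.inverse (1 - G ∘L K))

/-! ### Continuous time: the extended space `L_{2e}^n` -/

/-- Lebesgue measure on the half-line `ℝ₊ = [0, ∞)`. -/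
abbrev halfLine : Measure ℝ := volume.restrict (Ici 0)

/-- `L_{2e}^n` as a space of (classes of) measurable functions `ℝ₊ → ℝⁿ`: all truncations
`P_T f`, `T ≥ 0`, are in `L₂`. -/
def L2eSubmodule (n : ℕ) : Submodule ℝ (ℝ →ₘ[halfLine] EuclideanSpace ℝ (Fin n)) where
  carrier := {f | ∀ T : ℝ, 0 ≤ T → MemLp ((Iic T).indicator f) 2 halfLine}
  zero_mem' := by
    intro T _
    refine (MemLp.zero (p := 2) (μ := halfLine)
      (ε := EuclideanSpace ℝ (Fin n))).ae_eq ?_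
    filter_upwards [AEEqFun.coeFn_zero (μ := halfLine) (α := ℝ)
      (β := EuclideanSpace ℝ (Fin n))] with t ht
    by_cases h : t ∈ Iic T <;> simp [h, ht]
  add_mem' := by
    intro f g hf hg T hT
    refine ((hf T hT).add (hg T hT)).ae_eq ?_
    filter_upwards [AEEqFun.coeFn_add f g] with t ht
    by_cases h : t ∈ Iic T <;> simp [h, ht]
  smul_mem' := by
    intro c f hf T hT
    refine ((hf T hT).const_smul c).ae_eq ?_
    filter_upwards [AEEqFun.coeFn_smul c f] with t ht
    by_cases h : t ∈ Iic T <;> simp [h, ht]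

/-- The extended space `L_{2e}^n`. -/
def L2e (n : ℕ) : Type := L2eSubmodule n

namespace L2e

variable {m n : ℕ}

instance : AddCommGroup (L2e n) := inferInstanceAs (AddCommGroup (L2eSubmodule n))

instance : Module ℝ (L2e n) := inferInstanceAs (Module ℝ (L2eSubmodule n))

/-- A signal is used as a function through a measurable representative. -/
instance : CoeFun (L2e n) (fun _ => ℝ → EuclideanSpace ℝ (Fin n)) := ⟨fun f => f.1⟩

theorem memLp_trunc (f : L2e n) (T : ℝ≥0) : MemLp ((Iic (T : ℝ)).indicator f) 2 halfLine :=
  f.2 T T.2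

/-- `P_T f` as an element of the Hilbert space `L₂^n`. -/
def truncLp (T : ℝ≥0) : L2e n →ₗ[ℝ] Lp (EuclideanSpace ℝ (Fin n)) 2 halfLine where
  toFun f := (memLp_trunc f T).toLp _
  map_add' f g := by
    rw [← MemLp.toLp_add, MemLp.toLp_eq_toLp_iff]
    filter_upwards [AEEqFun.coeFn_add f.1 g.1] with t ht
    have ht' : (f + g : L2e n) t = f t + g t := ht
    by_cases h : t ∈ Iic (T : ℝ) <;> simp [h, ht']
  map_smul' c f := by
    rw [RingHom.id_apply, ← MemLp.toLp_const_smul, MemLp.toLp_eq_toLp_iff]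
    filter_upwards [AEEqFun.coeFn_smul c f.1] with t ht
    have ht' : (c • f : L2e n) t = c • f t := ht
    by_cases h : t ∈ Iic (T : ℝ) <;> simp [h, ht']

/-- The seminorm `‖f‖_T = ‖P_T f‖_{L₂}`. -/
def truncNorm (n : ℕ) : SeminormFamily ℝ (L2e n) ℝ≥0 :=
  fun T => (normSeminorm ℝ (Lp (EuclideanSpace ℝ (Fin n)) 2 halfLine)).comp (truncLp T)

/-- The topology of `L_{2e}^n`, generated by the balls of all the seminorms `‖·‖_T`. -/
instance : TopologicalSpace (L2e n) := (truncNorm n).moduleFilterBasis.topology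

theorem withSeminorms_truncNorm : WithSeminorms (truncNorm n) := ⟨rfl⟩

instance : IsTopologicalAddGroup (L2e n) := withSeminorms_truncNorm.topologicalAddGroup

instance : ContinuousSMul ℝ (L2e n) := withSeminorms_truncNorm.continuousSMul

/-- The truncation operator `P_T`. -/
def trunc (T : ℝ≥0) (f : L2e n) : L2e n :=
  ⟨AEEqFun.mk ((Iic (T : ℝ)).indicator f) (memLp_trunc f T).1, by
    intro T' _
    refine ((memLp_trunc f T).indicator (s := Iic T') measurableSet_Iic).ae_eq ?_
    filter_upwards [AEEqFun.coeFn_mk ((Iic (T : ℝ)).indicator f) (memLp_trunc f T).1] with t ht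
    by_cases h : t ∈ Iic T' <;> simp [h, ht]⟩

theorem memLp_shift (f : L2e n) (T : ℝ≥0) (T' : ℝ) :
    MemLp ((Iic T').indicator ((Ici (T : ℝ)).indicator fun t => f (t - T))) 2 halfLine := by
  have h1 := (memLp_indicator_iff_restrict measurableSet_Ici).2
    (f.2 (max 0 (T' - T)) (le_max_left _ _))
  have h2 := h1.comp_measurePreserving (measurePreserving_sub_right volume (T : ℝ))
  have h3 := ((h2.indicator (s := Ici (T : ℝ)) measurableSet_Ici).indicator
    (s := Iic T') measurableSet_Iic).restrict (Ici 0)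
  convert h3 using 1
  ext1 t
  by_cases ha : t ≤ T'
  · by_cases hb : (T : ℝ) ≤ t
    · simp [indicator, ha, hb]
    · simp [indicator, hb]
  · simp [indicator, ha]

theorem aestronglyMeasurable_shift (f : L2e n) (T : ℝ≥0) :
    AEStronglyMeasurable ((Ici (T : ℝ)).indicator fun t => f (t - T)) halfLine :=
  ((f.1.stronglyMeasurable.comp_measurable (measurable_id.sub_const (T : ℝ))).indicator
    measurableSet_Ici).aestronglyMeasurable

/-- The shift operator `D_T`: `(D_T f)(t) = 0` for `t < T` and `f (t - T)` for `t ≥ T`. -/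
def shift (T : ℝ≥0) (f : L2e n) : L2e n :=
  ⟨AEEqFun.mk ((Ici (T : ℝ)).indicator fun t => f (t - T)) (aestronglyMeasurable_shift f T), by
    intro T' _
    refine (memLp_shift f T T').ae_eq ?_
    filter_upwards [AEEqFun.coeFn_mk _ (aestronglyMeasurable_shift f T)] with t ht
    by_cases h : t ∈ Iic T' <;> simp only [h, indicator_of_mem, not_false_eq_true,
      indicator_of_notMem, ht]⟩

/-- The set of continuous linear, causal (`P_T A P_T = P_T A` for `T ≥ 0`) and time-invariant
(`D_T A = A D_T` for `T > 0`) maps `L_{2e}^m → L_{2e}^n`. -/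
def LTI (m n : ℕ) : Set (L2e m →L[ℝ] L2e n) :=
  {A | (∀ T : ℝ≥0, ∀ f, trunc T (A (trunc T f)) = trunc T (A f)) ∧
    (∀ T : ℝ≥0, 0 < T → ∀ f, shift T (A f) = A (shift T f))}

/-- `‖A‖_T = ‖P_T A‖_{L₂ → L₂}`, the supremum of `‖A f‖_T` over the unit ball of `L₂^m`. -/
def opNorm (T : ℝ≥0) (A : L2e m →L[ℝ] L2e n) : ℝ≥0∞ :=
  ⨆ (f : L2e m) (_ : eLpNorm f 2 halfLine ≤ 1), ENNReal.ofReal (truncNorm n T (A f))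

/-- The topology on continuous linear maps `L_{2e}^m → L_{2e}^n` generated by all the open
`‖·‖_T`-balls. -/
@[reducible] def opTopology (m n : ℕ) : TopologicalSpace (L2e m →L[ℝ] L2e n) :=
  TopologicalSpace.generateFrom
    {B | ∃ (A : L2e m →L[ℝ] L2e n) (T : ℝ≥0) (r : ℝ≥0∞), 0 < r ∧
      B = {A' | opNorm T (A' - A) < r}}

/-- `a ∈ L_{∞e}`: a function on `ℝ₊` all whose truncations are in `L_∞`. -/
def MemLinfE (a : ℝ → ℝ) : Prop :=
  ∀ T : ℝ≥0, MemLp ((Iic (T : ℝ)).indicator a) ∞ halfLine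

/-- The function `a : ℝ₊ → ℝ^{n × m}` is the impulse response matrix of `A`:
`(A f)(t) = ∫₀ᵗ a(t - s) f(s) ds` for every `f`. -/
def IsImpulseResponse (A : L2e m →L[ℝ] L2e n) (a : ℝ → Matrix (Fin n) (Fin m) ℝ) : Prop :=
  ∀ f : L2e m, ∀ᵐ t ∂halfLine, ∀ i : Fin n,
    A f t i = ∑ j : Fin m, ∫ s in (0 : ℝ)..t, a (t - s) i j * f s j

/-- `S` is inert with respect to `G`: for all `K ∈ S` the impulse response matrix of `G K` is a
function with entries in `L_{∞e}`. -/
def IsInert {ny nu : ℕ} (G : L2e nu →L[ℝ] L2e ny) (S : Set (L2e ny →L[ℝ] L2e nu)) : Prop :=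
  ∀ K ∈ S, ∃ gk : ℝ → Matrix (Fin ny) (Fin ny) ℝ,
    (∀ i j, MemLinfE fun t => gk t i j) ∧ IsImpulseResponse (G ∘L K) gk

end L2e

/-! ### Discrete time: the extended space `ℓ_{2e}^n` -/

/-- The extended space `ℓ_{2e}^n`: all sequences in `ℝⁿ`, with the product topology, which is the
topology of the seminorms `‖·‖_T` (see `Seq2e.withSeminorms_truncNorm`). -/
abbrev Seq2e (n : ℕ) : Type := ℕ → EuclideanSpace ℝ (Fin n)

namespace Seq2e

variable {m n : ℕ}

/-- The truncation operator `P_T`. -/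
def trunc (T : ℕ) (f : Seq2e n) : Seq2e n := fun t => if t ≤ T then f t else 0

/-- The shift operator `D_T`. -/
def shift (T : ℕ) (f : Seq2e n) : Seq2e n := fun t => if t < T then 0 else f (t - T)

/-- The values of a sequence at times `0, …, T`, as a vector in a Euclidean space. -/
def restrictLp (T : ℕ) :
    Seq2e n →ₗ[ℝ] PiLp 2 (fun _ : Fin (T + 1) => EuclideanSpace ℝ (Fin n)) where
  toFun f := WithLp.toLp 2 fun t => f t
  map_add' _ _ := rfl
  map_smul' _ _ := rfl

/-- The seminorm `‖f‖_T = ‖P_T f‖_{ℓ₂} = (∑_{t ≤ T} ‖f(t)‖²)^{1/2}`. -/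
def truncNorm (n : ℕ) : SeminormFamily ℝ (Seq2e n) ℕ :=
  fun T => (normSeminorm ℝ (PiLp 2 fun _ : Fin (T + 1) => EuclideanSpace ℝ (Fin n))).comp
    (restrictLp T)

theorem withSeminorms_truncNorm : WithSeminorms (truncNorm n) := by
  rw [SeminormFamily.withSeminorms_iff_nhds_eq_iInf]
  apply le_antisymm
  · refine le_iInf fun T => ?_
    rw [← Filter.map_le_iff_le_comap]
    have hc : Continuous fun f : Seq2e n => ‖restrictLp T f‖ := by
      refine continuous_norm.comp ?_
      exact (PiLp.continuous_toLp 2 _).comp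
        (continuous_pi fun t : Fin (T + 1) => continuous_apply (t : ℕ))
    have h0 := hc.tendsto 0
    rw [map_zero, norm_zero] at h0
    exact h0
  · rw [nhds_pi, Filter.pi]
    refine le_iInf fun t => iInf_le_of_le t ?_
    rw [← Filter.map_le_iff_le_comap]
    change Filter.Tendsto (fun f : Seq2e n => f t) _ (𝓝 0)
    refine squeeze_zero_norm (a := fun f => truncNorm n t f) (fun f => ?_) Filter.tendsto_comap
    exact PiLp.norm_apply_le (restrictLp t f) (Fin.last t)

/-- The set of continuous linear, causal (`P_T A P_T = P_T A` for `T ≥ 0`) and time-invariant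
(`D_T A = A D_T` for `T > 0`) maps `ℓ_{2e}^m → ℓ_{2e}^n`. -/
def LTI (m n : ℕ) : Set (Seq2e m →L[ℝ] Seq2e n) :=
  {A | (∀ T : ℕ, ∀ f, trunc T (A (trunc T f)) = trunc T (A f)) ∧
    (∀ T : ℕ, 0 < T → ∀ f, shift T (A f) = A (shift T f))}

/-- `‖A‖_T = ‖P_T A‖_{ℓ₂ → ℓ₂}`, the supremum of `‖A f‖_T` over the unit ball of `ℓ₂^m`. -/
def opNorm (T : ℕ) (A : Seq2e m →L[ℝ] Seq2e n) : ℝ≥0∞ :=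
  ⨆ (f : Seq2e m) (_ : ∑' t, ‖f t‖ₑ ^ 2 ≤ 1), ENNReal.ofReal (truncNorm n T (A f))

/-- The topology on continuous linear maps `ℓ_{2e}^m → ℓ_{2e}^n` generated by all the open
`‖·‖_T`-balls. -/
@[reducible] def opTopology (m n : ℕ) : TopologicalSpace (Seq2e m →L[ℝ] Seq2e n) :=
  TopologicalSpace.generateFrom
    {B | ∃ (A : Seq2e m →L[ℝ] Seq2e n) (T : ℕ) (r : ℝ≥0∞), 0 < r ∧
      B = {A' | opNorm T (A' - A) < r}}

/-- The discrete impulse response matrix of `A`: column `j` of `impulseResponse A t` is the value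
at time `t` of the response to the unit impulse at time `0` in the `j`-th input. -/
def impulseResponse (A : Seq2e m →L[ℝ] Seq2e n) (t : ℕ) : Matrix (Fin n) (Fin m) ℝ :=
  Matrix.of fun i j => A (Pi.single 0 (EuclideanSpace.single j 1)) t i

/-- `S` is inert with respect to `G`: for all `K ∈ S`, the value at time `0` of the impulse
response matrix of `G K` has (complex) spectral radius less than `1`. The entries of the impulse
response are real sequences, hence always in `ℓ_e`. -/
def IsInert {ny nu : ℕ} (G : Seq2e nu →L[ℝ] Seq2e ny) (S : Set (Seq2e ny →L[ℝ] Seq2e nu)) :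
    Prop :=
  ∀ K ∈ S, spectralRadius ℂ ((impulseResponse (G ∘L K) 0).map (fun x : ℝ => (x : ℂ))) < 1

end Seq2e

end

/-! The map `h` is an involution wherever it is defined: `1 - G h(K) = (1 - GK)⁻¹`, hence `h(h(K)) =
K` (`hMap_hMap`). It therefore suffices to show `h(S) ⊆ S`. Let `Q ∈ h(S)`. Star-shapedness gives
`αQ = h(K_α)` with `K_α ∈ S` for small `α > 0`. Then `-α⁻¹ K_α`, which is `Q (1 - αGQ)⁻¹` in
disguise, lies in `S` by homogeneity and tends to `Q` as `α → 0`; closedness puts `Q` in `S`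
(`hMap_image_eq_self`). Convergence is checked in one seminorm at a time, which is possible because
causality bounds an operator on each `[0,T]` by the seminorm with the same `T`
(`isSeminormBounded_of_truncation`). Inertness supplies invertibility of `1 - GK` with bounds on
each `[0,T]`. In discrete time the feedthrough `D` of `GK` has `1 - D` invertible, and the equation
is solved one instant at a time (`Seq2e.LTI.isUnit_one_sub`). In continuous time `GK` is a Volterra
operator, whose Neumann series converges factorially (`L2e.IsVolterra.isUnit_one_sub`). -/

section SeminormBounds

/-! ### Operators bounded seminorm by seminorm. -/

variable {ι Y U W : Type*} [AddCommGroup U] [Module ℝ U] [TopologicalSpace U]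
  [AddCommGroup Y] [Module ℝ Y] [TopologicalSpace Y]
  [AddCommGroup W] [Module ℝ W] [TopologicalSpace W]

/-- `A` is bounded for each pair of seminorms with the same index. -/
def IsSeminormBounded (p : SeminormFamily ℝ Y ι) (q : SeminormFamily ℝ U ι) (A : Y →L[ℝ] U) :
    Prop :=
  ∀ T, ∃ C : ℝ, 0 ≤ C ∧ ∀ f, q T (A f) ≤ C * p T f

namespace IsSeminormBounded

variable {p : SeminormFamily ℝ Y ι} {q : SeminormFamily ℝ U ι} {r : SeminormFamily ℝ W ι}

theorem comp {A : U →L[ℝ] W} {B : Y →L[ℝ] U} (hA : IsSeminormBounded q r A)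
    (hB : IsSeminormBounded p q B) : IsSeminormBounded p r (A ∘L B) := by
  intro T
  obtain ⟨C, hC, h⟩ := hA T
  obtain ⟨D, hD, h'⟩ := hB T
  refine ⟨C * D, mul_nonneg hC hD, fun f => (h (B f)).trans ?_⟩
  rw [mul_assoc]
  exact mul_le_mul_of_nonneg_left (h' f) hC

theorem neg [IsTopologicalAddGroup U] {A : Y →L[ℝ] U} (hA : IsSeminormBounded p q A) :
    IsSeminormBounded p q (-A) := by
  intro T
  obtain ⟨C, hC, h⟩ := hA T
  exact ⟨C, hC, fun f => by simpa using h f⟩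

end IsSeminormBounded

/-- A continuous operator is bounded for each pair of seminorms if it is causal with respect to
truncations `P`. -/
theorem isSeminormBounded_of_truncation {p : SeminormFamily ℝ Y ι} {q : SeminormFamily ℝ U ι}
    (hp : WithSeminorms p) (hq : WithSeminorms q) {A : Y →L[ℝ] U} (P : ι → Y → Y)
    (hP : ∀ T T' f, p T' (P T f) ≤ p T f) (hA : ∀ T f, q T (A (P T f)) = q T (A f)) :
    IsSeminormBounded p q A := by
  intro T
  -- Continuity only gives a bound by finitely many seminorms. Applied to `P T f`, each of them is
  -- at most `p T f`.
  obtain ⟨s, C, -, h⟩ := Seminorm.bound_of_continuous hp ((q T).comp (A : Y →ₗ[ℝ] U))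
    ((hq.continuous_seminorm T).comp A.continuous)
  refine ⟨C, C.2, fun f => ?_⟩
  rw [← hA]
  refine (h (P T f)).trans ?_
  change (C : ℝ) * _ ≤ _
  exact mul_le_mul_of_nonneg_left
    (Seminorm.finset_sup_apply_le (apply_nonneg _ _) fun T' _ => hP T T' f) C.2

/-- In the topology generated by the balls of the operator seminorms, a closed set contains the
limits of its sequences that converge in each of these seminorms. -/
theorem mem_of_isClosed_generateFrom_opNorm [IsTopologicalAddGroup U]
    {p : SeminormFamily ℝ Y ι} {q : SeminormFamily ℝ U ι} {D : Y → Prop}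
    (hD : ∀ f, D f → ∀ T, p T f ≤ 1) {N : ι → (Y →L[ℝ] U) → ℝ≥0∞}
    (hN : ∀ T A, N T A = ⨆ (f : Y) (_ : D f), ENNReal.ofReal (q T (A f)))
    {S : Set (Y →L[ℝ] U)}
    (hS : IsClosed[TopologicalSpace.generateFrom
      {B | ∃ (A : Y →L[ℝ] U) (T : ι) (r : ℝ≥0∞), 0 < r ∧ B = {A' | N T (A' - A) < r}}] S)
    (Q : Y →L[ℝ] U) (u : ℕ → Y →L[ℝ] U) (hu : ∀ n, u n ∈ S)
    (hlim : ∀ T, ∃ ε : ℕ → ℝ, Filter.Tendsto ε Filter.atTop (𝓝 0) ∧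
      ∀ᶠ n in Filter.atTop, ∀ f, q T ((u n - Q) f) ≤ ε n * p T f) : Q ∈ S := by
  have hadd : ∀ T A B, N T (A + B) ≤ N T A + N T B := by
    intro T A B
    simp only [hN]
    refine iSup₂_le fun f hf => ?_
    refine (ENNReal.ofReal_le_ofReal (map_add_le_add (q T) (A f) (B f))).trans ?_
    refine ENNReal.ofReal_add_le.trans (add_le_add ?_ ?_)
    · exact le_iSup₂ (f := fun f (_ : D f) => ENNReal.ofReal (q T (A f))) f hf
    · exact le_iSup₂ (f := fun f (_ : D f) => ENNReal.ofReal (q T (B f))) f hf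
  have hzero : ∀ T, Filter.Tendsto (fun n => N T (u n - Q)) Filter.atTop (𝓝 0) := by
    intro T
    obtain ⟨ε, hε, h⟩ := hlim T
    have hε' : Filter.Tendsto (fun n => ENNReal.ofReal |ε n|) Filter.atTop (𝓝 0) := by
      simpa using ENNReal.tendsto_ofReal hε.abs
    refine tendsto_of_tendsto_of_tendsto_of_le_of_le' tendsto_const_nhds hε'
      (Filter.Eventually.of_forall fun n => zero_le) ?_
    filter_upwards [h] with n hn
    rw [hN]
    refine iSup₂_le fun f hf => ENNReal.ofReal_le_ofReal ((hn f).trans ?_)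
    calc ε n * p T f ≤ |ε n| * p T f :=
          mul_le_mul_of_nonneg_right (le_abs_self _) (apply_nonneg _ _)
      _ ≤ |ε n| * 1 := mul_le_mul_of_nonneg_left (hD f hf T) (abs_nonneg _)
      _ = |ε n| := mul_one _
  refine @IsClosed.mem_of_tendsto _ (_) _ Q S u Filter.atTop _ hS ?_
    (Filter.Eventually.of_forall hu)
  -- The subbasic sets are balls around arbitrary `A`, so subadditivity of `N T` transfers smallness
  -- of `u n - Q` to them.
  rw [TopologicalSpace.tendsto_nhds_generateFrom_iff]
  rintro - ⟨A, T, r, -, rfl⟩ hQ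
  have hQ' : N T (Q - A) < r := hQ
  have : Filter.Tendsto (fun n => N T (u n - Q) + N T (Q - A)) Filter.atTop
      (𝓝 (0 + N T (Q - A))) := (hzero T).add tendsto_const_nhds
  rw [zero_add] at this
  filter_upwards [this.eventually_lt_const hQ'] with n hn
  have h := hadd T (u n - Q) (Q - A)
  rw [sub_add_sub_cancel] at h
  exact h.trans_lt hn

/-- A surjective operator which is bounded below for each seminorm of a separating family is
invertible, and its inverse is bounded for each seminorm. -/
theorem isUnit_of_seminorm_boundedBelow [IsTopologicalAddGroup Y] {p : SeminormFamily ℝ Y ι}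
    (hp : WithSeminorms p) (hsep : ∀ g, (∀ T, p T g = 0) → g = 0) {L : Y →L[ℝ] Y}
    (hsurj : Function.Surjective L) (hL : ∀ T, ∃ C : ℝ, 0 ≤ C ∧ ∀ g, p T g ≤ C * p T (L g)) :
    IsUnit L ∧ IsSeminormBounded p p (Ring.inverse L) := by
  have hinj : Function.Injective L := by
    rw [injective_iff_map_eq_zero]
    intro g hg
    refine hsep g fun T => ?_
    obtain ⟨C, -, h⟩ := hL T
    refine le_antisymm ?_ (apply_nonneg _ _)
    simpa [hg] using h g
  let e : Y ≃ₗ[ℝ] Y := LinearEquiv.ofBijective (L : Y →ₗ[ℝ] Y) ⟨hinj, hsurj⟩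
  have he : ∀ f, L (e.symm f) = f := fun f => e.apply_symm_apply f
  have he' : ∀ f, e.symm (L f) = f := fun f => e.symm_apply_apply f
  -- The lower bound, read at `e.symm f`, is already continuity of the inverse; no open mapping
  -- theorem is involved.
  have hb : ∀ T, ∃ C : ℝ, 0 ≤ C ∧ ∀ f, p T (e.symm f) ≤ C * p T f := by
    intro T
    obtain ⟨C, hC, h⟩ := hL T
    exact ⟨C, hC, fun f => by simpa only [he] using h (e.symm f)⟩
  have hcont : Continuous (e.symm : Y →ₗ[ℝ] Y) := by
    refine WithSeminorms.continuous_of_isBounded hp hp _ fun T => ?_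
    obtain ⟨C, hC, h⟩ := hb T
    refine ⟨{T}, ⟨C, hC⟩, ?_⟩
    rw [Finset.sup_singleton]
    exact h
  let R : Y →L[ℝ] Y := ⟨e.symm, hcont⟩
  let u : (Y →L[ℝ] Y)ˣ := ⟨L, R, by ext f; exact he f, by ext f; exact he' f⟩
  have hu : Ring.inverse L = R := Ring.inverse_unit u
  refine ⟨u.isUnit, ?_⟩
  rw [hu]
  exact hb

/-! ### The involution `h` and the limit argument. -/

variable [IsTopologicalAddGroup Y] [IsTopologicalAddGroup U]

/-- `1 - G h(K) = 1 + GK(1 - GK)⁻¹ = (1 - GK)⁻¹` is again a unit, with inverse `1 - GK`; so `h(h(K))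
= -h(K)(1 - GK) = K`. -/
theorem hMap_hMap {G : U →L[ℝ] Y} {K : Y →L[ℝ] U} (h : IsUnit (1 - G ∘L K)) :
    hMap G (hMap G K) = K := by
  obtain ⟨u, hu⟩ := h
  have h1 : Ring.inverse (1 - G ∘L K) = ((u⁻¹ : (Y →L[ℝ] Y)ˣ) : Y →L[ℝ] Y) := by
    rw [← hu, Ring.inverse_unit]
  have h2 : ∀ f, (u⁻¹ : (Y →L[ℝ] Y)ˣ).1 f - G (K ((u⁻¹ : (Y →L[ℝ] Y)ˣ).1 f)) = f := by
    intro f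
    have := congrArg (fun A : Y →L[ℝ] Y => A f) u.mul_inv
    rw [hu] at this
    exact this
  have h3 : ∀ f, (u⁻¹ : (Y →L[ℝ] Y)ˣ).1 (f - G (K f)) = f := by
    intro f
    have := congrArg (fun A : Y →L[ℝ] Y => A f) u.inv_mul
    rw [hu] at this
    exact this
  have h4 : 1 - G ∘L hMap G K = ((u⁻¹ : (Y →L[ℝ] Y)ˣ) : Y →L[ℝ] Y) := by
    ext f
    have := h2 f
    simp only [hMap, h1, sub_apply, one_apply_eq_self,
      ContinuousLinearMap.comp_apply, neg_apply, map_neg, sub_neg_eq_add]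
    nth_rewrite 1 [← this]
    abel
  have h5 : hMap G (hMap G K) = -(hMap G K ∘L (u : Y →L[ℝ] Y)) := by
    have : Ring.inverse (1 - G ∘L hMap G K) = (u : Y →L[ℝ] Y) := by
      rw [h4, Ring.inverse_unit, inv_inv]
    rw [← this]; rfl
  rw [h5]
  ext f
  simp only [hMap, h1, hu, sub_apply, one_apply_eq_self,
      ContinuousLinearMap.comp_apply, neg_apply, neg_neg, h3]

/-- If `h(K') = α Q` with `α ≠ 0`, then `K = -α⁻¹ K'` satisfies `K = Q + α Q G K`. -/
theorem apply_of_hMap_eq_smul {G : U →L[ℝ] Y} {K Q : Y →L[ℝ] U} {α : ℝ} (hα : α ≠ 0)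
    (h : IsUnit (1 - G ∘L K)) (hK : ∀ f, hMap G K f = α • Q f) (f : Y) :
    (-α⁻¹) • K f = Q f + α • Q (G ((-α⁻¹) • K f)) := by
  have h1 : ∀ f, Ring.inverse (1 - G ∘L K) (f - G (K f)) = f := fun f =>
    congrArg (fun A : Y →L[ℝ] Y => A f) (Ring.inverse_mul_cancel _ h)
  -- Evaluating at `(1 - GK) f` cancels the inverse inside `h`.
  have h2 := hK (f - G (K f))
  have h3 : hMap G K (f - G (K f)) = - K f := by
    conv_rhs => rw [← h1 f]
    rfl
  rw [h3, map_sub] at h2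
  have h4 : K f = -(α • (Q f - Q (G (K f)))) := by rw [← h2, neg_neg]
  rw [map_smul, map_smul, smul_smul, mul_neg, mul_inv_cancel₀ hα, neg_one_smul, ← sub_eq_add_neg]
  conv_lhs => rw [h4]
  rw [smul_neg, neg_smul, neg_neg, smul_smul, inv_mul_cancel₀ hα, one_smul]

/-- The purely algebraic and metric part of the argument: if `h(S)` is star-shaped, then
`h(S) = S`, for a homogeneous set `S` that is closed for convergence in all operator seminorms. -/
theorem hMap_image_eq_self {p : SeminormFamily ℝ Y ι} {q : SeminormFamily ℝ U ι}
    {G : U →L[ℝ] Y} {S : Set (Y →L[ℝ] U)} (hG : IsSeminormBounded q p G)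
    (hunit : ∀ K ∈ S, IsUnit (1 - G ∘L K)) (hbdd : ∀ K ∈ S, IsSeminormBounded p q (hMap G K))
    (hhom : ∀ K ∈ S, ∀ α : ℝ, ∃ K' ∈ S, ∀ f, K' f = α • K f)
    (hclosed : ∀ (Q : Y →L[ℝ] U) (u : ℕ → Y →L[ℝ] U), (∀ n, u n ∈ S) →
      (∀ T, ∃ ε : ℕ → ℝ, Filter.Tendsto ε Filter.atTop (𝓝 0) ∧
        ∀ᶠ n in Filter.atTop, ∀ f, q T ((u n - Q) f) ≤ ε n * p T f) → Q ∈ S)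
    (hstar : ∀ Q ∈ hMap G '' S, ∀ α ∈ Icc (0 : ℝ) 1, ∃ Q' ∈ hMap G '' S, ∀ f, Q' f = α • Q f) :
    hMap G '' S = S := by
  have hsub : hMap G '' S ⊆ S := by
    rintro Q hQ
    have hQb : IsSeminormBounded p q Q := by
      obtain ⟨K, hK, rfl⟩ := hQ
      exact hbdd K hK
    -- The approximants to `Q` are given by an implicit equation, so invertibility of `1 - αGQ` is
    -- never needed.
    have key : ∀ n : ℕ, ∃ K ∈ S, ∀ f, K f = Q f + (1 / ((n : ℝ) + 1)) • Q (G (K f)) := by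
      intro n
      have hα : (1 / ((n : ℝ) + 1)) ≠ 0 := by positivity
      obtain ⟨-, ⟨K, hK, rfl⟩, hKQ⟩ := hstar Q hQ (1 / ((n : ℝ) + 1))
        ⟨by positivity, (div_le_one (by positivity)).2 (by simp)⟩
      obtain ⟨K', hK', hKK'⟩ := hhom K hK (-(1 / ((n : ℝ) + 1))⁻¹)
      refine ⟨K', hK', fun f => ?_⟩
      rw [hKK']
      exact apply_of_hMap_eq_smul hα (hunit K hK) hKQ f
    choose u huS hu using key
    refine hclosed Q u huS fun T => ?_
    obtain ⟨C₁, hC₁, h₁⟩ := hQb T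
    obtain ⟨C₂, hC₂, h₂⟩ := hQb.comp hG T
    have hlim : Filter.Tendsto (fun n : ℕ => 1 / ((n : ℝ) + 1)) Filter.atTop (𝓝 0) :=
      tendsto_one_div_add_atTop_nhds_zero_nat
    -- Once `α C₂ < 1/2`, the term `αQGK` is absorbed and `q T (K f) ≤ 2 C₁ p T f`; the error `αQGK
    -- f` then costs a further factor `α C₂`.
    refine ⟨fun n => (1 / ((n : ℝ) + 1)) * (C₂ * (2 * C₁)), ?_, ?_⟩
    · simpa using hlim.mul_const (C₂ * (2 * C₁))
    · have hev : ∀ᶠ n : ℕ in Filter.atTop, (1 / ((n : ℝ) + 1)) * C₂ < 1 / 2 := by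
        have := hlim.mul_const C₂
        rw [zero_mul] at this
        exact this.eventually_lt_const (by norm_num)
      filter_upwards [hev] with n hn f
      have hα : 0 ≤ 1 / ((n : ℝ) + 1) := by positivity
      set α := 1 / ((n : ℝ) + 1)
      have e1 : q T (α • Q (G (u n f))) ≤ α * (C₂ * q T (u n f)) := by
        rw [map_smul_eq_mul, Real.norm_of_nonneg hα]
        exact mul_le_mul_of_nonneg_left (h₂ (u n f)) hα
      have e2 : q T (u n f) ≤ 2 * C₁ * p T f := by
        have := (congrArg (q T) (hu n f)).le.trans (map_add_le_add (q T) _ _)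
        nlinarith [h₁ f, apply_nonneg (q T) (u n f)]
      have e3 : (u n - Q) f = α • Q (G (u n f)) := by
        rw [sub_apply, sub_eq_iff_eq_add']
        exact hu n f
      rw [e3]
      refine e1.trans ?_
      rw [mul_assoc, mul_assoc]
      exact mul_le_mul_of_nonneg_left (mul_le_mul_of_nonneg_left e2 hC₂) hα
  refine hsub.antisymm fun K hK => ?_
  exact ⟨hMap G K, hsub ⟨K, hK, rfl⟩, hMap_hMap (hunit K hK)⟩

end SeminormBounds

/-! ### Discrete time: recursion in time. -/

namespace Seq2e

variable {l m n : ℕ}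

theorem truncNorm_sq (T : ℕ) (f : Seq2e n) :
    truncNorm n T f ^ 2 = ∑ t ∈ Finset.range (T + 1), ‖f t‖ ^ 2 := by
  rw [Finset.sum_range fun t => ‖f t‖ ^ 2]
  exact PiLp.norm_sq_eq_of_L2 _ (restrictLp T f)

theorem truncNorm_congr {T : ℕ} {f g : Seq2e n} (h : ∀ t ≤ T, f t = g t) :
    truncNorm n T f = truncNorm n T g := by
  rw [← sq_eq_sq₀ (apply_nonneg _ _) (apply_nonneg _ _), truncNorm_sq, truncNorm_sq]
  refine Finset.sum_congr rfl fun t ht => ?_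
  rw [h t (Nat.lt_succ_iff.1 (Finset.mem_range.1 ht))]

theorem norm_apply_le_truncNorm {t T : ℕ} (h : t ≤ T) (f : Seq2e n) :
    ‖f t‖ ≤ truncNorm n T f := by
  rw [← sq_le_sq₀ (norm_nonneg _) (apply_nonneg _ _), truncNorm_sq]
  exact Finset.single_le_sum (f := fun t => ‖f t‖ ^ 2) (fun _ _ => by positivity)
    (Finset.mem_range.2 (Nat.lt_succ_iff.2 h))

theorem truncNorm_le_sum (T : ℕ) (f : Seq2e n) :
    truncNorm n T f ≤ ∑ t ∈ Finset.range (T + 1), ‖f t‖ := by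
  rw [← sq_le_sq₀ (apply_nonneg _ _) (Finset.sum_nonneg fun _ _ => norm_nonneg _), truncNorm_sq]
  exact Finset.sum_sq_le_sq_sum_of_nonneg fun _ _ => norm_nonneg _

theorem truncNorm_trunc_le (T T' : ℕ) (f : Seq2e n) :
    truncNorm n T' (trunc T f) ≤ truncNorm n T f := by
  rw [← sq_le_sq₀ (apply_nonneg _ _) (apply_nonneg _ _), truncNorm_sq, truncNorm_sq]
  have h : ∀ t, ‖trunc T f t‖ ^ 2 = if t ≤ T then ‖f t‖ ^ 2 else 0 := by
    intro t
    by_cases ht : t ≤ T <;> simp [trunc, ht]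
  simp only [h]
  rw [← Finset.sum_filter]
  refine Finset.sum_le_sum_of_subset_of_nonneg (fun t ht => ?_) fun _ _ _ => by positivity
  rw [Finset.mem_filter] at ht
  exact Finset.mem_range.2 (Nat.lt_succ_iff.2 ht.2)

theorem truncNorm_le_one {f : Seq2e n} (hf : ∑' t, ‖f t‖ₑ ^ 2 ≤ 1) (T : ℕ) :
    truncNorm n T f ≤ 1 := by
  rw [← sq_le_sq₀ (apply_nonneg _ _) zero_le_one, truncNorm_sq, one_pow,
    ← ENNReal.ofReal_le_one, ENNReal.ofReal_sum_of_nonneg fun _ _ => by positivity]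
  refine le_trans ?_ hf
  simp only [ENNReal.ofReal_pow (norm_nonneg _), ofReal_norm]
  exact ENNReal.sum_le_tsum _

theorem LTI.apply_congr {A : Seq2e m →L[ℝ] Seq2e n} (hA : A ∈ LTI m n) {t : ℕ} {f g : Seq2e m}
    (h : ∀ s ≤ t, f s = g s) : A f t = A g t := by
  have hfg : trunc t f = trunc t g := by
    ext1 s
    by_cases hs : s ≤ t <;> simp [trunc, hs, h]
  have h1 := congrFun (hA.1 t f) t
  have h2 := congrFun (hA.1 t g) t
  rw [hfg] at h1
  simpa [trunc] using h1.symm.trans h2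

theorem LTI.isSeminormBounded {A : Seq2e m →L[ℝ] Seq2e n} (hA : A ∈ LTI m n) :
    IsSeminormBounded (truncNorm m) (truncNorm n) A :=
  isSeminormBounded_of_truncation withSeminorms_truncNorm withSeminorms_truncNorm trunc
    truncNorm_trunc_le fun T f => truncNorm_congr fun t ht => LTI.apply_congr hA fun s hs => by
      simp [trunc, hs.trans ht]

theorem LTI.comp {A : Seq2e m →L[ℝ] Seq2e n} {B : Seq2e l →L[ℝ] Seq2e m} (hA : A ∈ LTI m n)
    (hB : B ∈ LTI l m) : A ∘L B ∈ LTI l n := by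
  refine ⟨fun T f => ?_, fun T hT f => ?_⟩
  · simp only [ContinuousLinearMap.comp_apply]
    rw [← hA.1 T (B (trunc T f)), hB.1, hA.1]
  · simp only [ContinuousLinearMap.comp_apply]
    rw [hA.2 T hT, hB.2 T hT]

/-- The instantaneous response (the feedthrough) of an operator. -/
def feedthrough (A : Seq2e m →L[ℝ] Seq2e n) :
    EuclideanSpace ℝ (Fin m) →ₗ[ℝ] EuclideanSpace ℝ (Fin n) :=
  LinearMap.proj 0 ∘ₗ (A : Seq2e m →ₗ[ℝ] Seq2e n) ∘ₗ
    LinearMap.single ℝ (fun _ : ℕ => EuclideanSpace ℝ (Fin m)) 0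

/-- By time invariance the feedthrough is the same at every instant: an impulse at `t` is a shifted
impulse at `0`. -/
theorem LTI.apply_single {A : Seq2e m →L[ℝ] Seq2e n} (hA : A ∈ LTI m n) (t : ℕ)
    (v : EuclideanSpace ℝ (Fin m)) : A (Pi.single t v) t = feedthrough A v := by
  rcases Nat.eq_zero_or_pos t with rfl | ht
  · rfl
  · have h : shift t (Pi.single 0 v) = (Pi.single t v : Seq2e m) := by
      ext1 s
      rcases lt_trichotomy s t with hs | rfl | hs
      · simp [shift, hs, hs.ne]
      · simp [shift]
      · have : s - t ≠ 0 := by omega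
        simp [shift, hs.not_gt, hs.ne', this]
    rw [← h, ← hA.2 t ht]
    simp [shift, feedthrough]

/-- By causality the output at `t` sees only the strict past and the present value. This splitting
drives both the lower bound and the construction of solutions. -/
theorem LTI.apply_eq_add_feedthrough {A : Seq2e m →L[ℝ] Seq2e n} (hA : A ∈ LTI m n) (t : ℕ)
    (f : Seq2e m) :
    A f t = A (fun s => if s < t then f s else 0) t + feedthrough A (f t) := by
  rw [← LTI.apply_single hA, ← Pi.add_apply, ← map_add]
  refine LTI.apply_congr hA fun s hs => ?_
  rcases hs.lt_or_eq with hs | rfl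
  · simp [hs, hs.ne]
  · simp

theorem feedthrough_apply (A : Seq2e m →L[ℝ] Seq2e n) (v : EuclideanSpace ℝ (Fin m)) (i : Fin n) :
    feedthrough A v i = (impulseResponse A 0).mulVec v i := by
  have hv : v = ∑ j, v j • EuclideanSpace.single j (1 : ℝ) := by
    simpa using ((EuclideanSpace.basisFun (Fin m) ℝ).sum_repr v).symm
  conv_lhs => rw [hv]
  rw [map_sum]
  simp only [map_smul, WithLp.ofLp_sum, Finset.sum_apply, Matrix.mulVec, dotProduct,
    PiLp.smul_apply, smul_eq_mul]
  exact Finset.sum_congr rfl fun j _ => mul_comm _ _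

/-- The spectral radius bound makes `1` a regular value of the complexified matrix; invertibility
descends to `ℝ` through the determinant. -/
theorem ker_id_sub_feedthrough {A : Seq2e n →L[ℝ] Seq2e n}
    (hA : spectralRadius ℂ ((impulseResponse A 0).map (fun x : ℝ => (x : ℂ))) < 1) :
    (LinearMap.id - feedthrough A).ker = ⊥ := by
  set M := impulseResponse A 0
  have h1 : IsUnit (1 - M.map (fun x : ℝ => (x : ℂ))) := by
    have h : (1 : ℂ) ∈ resolventSet ℂ (M.map (fun x : ℝ => (x : ℂ))) :=
      spectrum.mem_resolventSet_of_spectralRadius_lt (by simpa using hA)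
    simpa [spectrum.mem_resolventSet_iff] using h
  have h2 : IsUnit (1 - M) := by
    rw [Matrix.isUnit_iff_isUnit_det, isUnit_iff_ne_zero] at h1 ⊢
    intro h0
    apply h1
    have h3 := RingHom.map_det Complex.ofRealHom (1 - M)
    rw [h0, map_zero, map_sub, map_one] at h3
    exact h3.symm
  rw [LinearMap.ker_eq_bot']
  intro v hv
  have h3 : (1 - M).mulVec v = 0 := by
    ext i
    rw [Matrix.sub_mulVec, Matrix.one_mulVec, Pi.sub_apply, ← feedthrough_apply]
    exact congrArg (fun w : EuclideanSpace ℝ (Fin n) => w i) hv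
  have h4 := Matrix.mulVec_injective_iff_isUnit.2 h2 (h3.trans (Matrix.mulVec_zero _).symm)
  ext i
  exact congrFun h4 i

/-- Induction on time: `(1 - D) g(N)` is the residual at `N` plus the response to the strict past,
which the induction hypothesis controls. Sums of norms replace `truncNorm` because they grow by one
term per step. -/
theorem LTI.boundedBelow {A : Seq2e n →L[ℝ] Seq2e n} (hA : A ∈ LTI n n)
    (hker : (LinearMap.id - feedthrough A).ker = ⊥) (N : ℕ) :
    ∃ C : ℝ, 0 ≤ C ∧ ∀ g, ∑ t ∈ Finset.range N, ‖g t‖ ≤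
      C * ∑ t ∈ Finset.range N, ‖(1 - A) g t‖ := by
  obtain ⟨c, -, hc⟩ := LinearMap.exists_antilipschitzWith _ hker
  have hc' : ∀ v, ‖v‖ ≤ c * ‖v - feedthrough A v‖ := fun v =>
    hc.le_mul_norm (map_zero _) v
  induction N with
  | zero => exact ⟨0, le_rfl, fun g => by simp⟩
  | succ N ih =>
    obtain ⟨C, hC, h⟩ := ih
    obtain ⟨D, hD, h'⟩ := LTI.isSeminormBounded hA N
    -- `C` pays for the earlier values, `c` for the residual at `N`, and `c * (D * C)` for the
    -- influence of the past on `g N`.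
    refine ⟨C + c + c * (D * C), by positivity, fun g => ?_⟩
    rw [Finset.sum_range_succ, Finset.sum_range_succ]
    set r := ∑ t ∈ Finset.range N, ‖(1 - A) g t‖
    have hr : 0 ≤ r := Finset.sum_nonneg fun _ _ => norm_nonneg _
    set g' : Seq2e n := fun s => if s < N then g s else 0
    have e1 : g N - feedthrough A (g N) = (1 - A) g N + A g' N := by
      change _ = g N - A g N + A g' N
      rw [LTI.apply_eq_add_feedthrough hA N g]
      abel
    have e2 : ‖A g' N‖ ≤ D * (C * r) := by
      refine (norm_apply_le_truncNorm le_rfl _).trans ((h' g').trans ?_)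
      refine mul_le_mul_of_nonneg_left ((truncNorm_le_sum _ _).trans ?_) hD
      rw [Finset.sum_range_succ]
      have : ∑ t ∈ Finset.range N, ‖g' t‖ = ∑ t ∈ Finset.range N, ‖g t‖ :=
        Finset.sum_congr rfl fun t ht => by simp [g', Finset.mem_range.1 ht]
      rw [this]
      have hN : g' N = 0 := by simp [g']
      rw [hN, norm_zero, add_zero]
      exact h g
    have e3 : ‖g N‖ ≤ c * (‖(1 - A) g N‖ + D * (C * r)) := by
      refine (hc' (g N)).trans (mul_le_mul_of_nonneg_left ?_ c.2)
      rw [e1]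
      exact (norm_add_le _ _).trans (by gcongr)
    have h3 : 0 ≤ (C + c * (D * C)) * ‖(1 - A) g N‖ := by positivity
    have h4 : 0 ≤ (c : ℝ) * r := by positivity
    nlinarith [h g]

theorem LTI.surjective_one_sub {A : Seq2e n →L[ℝ] Seq2e n} (hA : A ∈ LTI n n)
    (hker : (LinearMap.id - feedthrough A).ker = ⊥) :
    Function.Surjective (1 - A : Seq2e n →L[ℝ] Seq2e n) := by
  have hsurj := LinearMap.injective_iff_surjective.1 (LinearMap.ker_eq_bot.1 hker)
  choose B hB using hsurj
  intro f
  let step : ℕ → Seq2e n → Seq2e n := fun N g => Function.update g N (B (f N + A g N))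
  -- `G N` carries the solution at times below `N` and vanishes from `N` on, so `A (G N) N` is the
  -- response to the strict past; the solution is read off the diagonal.
  let G : ℕ → Seq2e n := fun N => Nat.rec 0 step N
  have hG : ∀ N, G (N + 1) = Function.update (G N) N (B (f N + A (G N) N)) := fun N => rfl
  have hG0 : ∀ N s, N ≤ s → G N s = 0 := by
    intro N
    induction N with
    | zero => exact fun s _ => rfl
    | succ N ih =>
      intro s hs
      rw [hG, Function.update_of_ne (by omega), ih s (by omega)]
  have hG1 : ∀ N s, s < N → G N s = G (s + 1) s := by
    intro N
    induction N with
    | zero => exact fun s hs => absurd hs (Nat.not_lt_zero s)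
    | succ N ih =>
      intro s hs
      rcases (Nat.lt_succ_iff.1 hs).lt_or_eq with h | rfl
      · rw [hG, Function.update_of_ne h.ne, ih s h]
      · rfl
  refine ⟨fun t => G (t + 1) t, ?_⟩
  ext1 t
  set g : Seq2e n := fun t => G (t + 1) t
  have h1 : (fun s => if s < t then g s else 0) = G t := by
    ext1 s
    by_cases hs : s < t
    · simp only [hs, if_true, g, hG1 t s hs]
    · simp only [hs, if_false, hG0 t s (not_lt.1 hs)]
  have h2 : g t = B (f t + A (G t) t) := by simp [g, hG]
  have h3 := hB (f t + A (G t) t)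
  rw [← h2] at h3
  change g t - A g t = f t
  rw [LTI.apply_eq_add_feedthrough hA t g, h1]
  change g t - feedthrough A (g t) = _ at h3
  rw [add_comm, ← sub_sub, h3, add_sub_cancel_right]

/-- Invertibility of `1 - A`, with a bounded inverse, for an instantaneous response of spectral
radius less than `1`. -/
theorem LTI.isUnit_one_sub {A : Seq2e n →L[ℝ] Seq2e n} (hA : A ∈ LTI n n)
    (hr : spectralRadius ℂ ((impulseResponse A 0).map (fun x : ℝ => (x : ℂ))) < 1) :
    IsUnit (1 - A) ∧ IsSeminormBounded (truncNorm n) (truncNorm n) (Ring.inverse (1 - A)) := by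
  have hker := ker_id_sub_feedthrough hr
  refine isUnit_of_seminorm_boundedBelow withSeminorms_truncNorm (fun g hg => ?_)
    (LTI.surjective_one_sub hA hker) fun T => ?_
  · ext1 t
    rw [Pi.zero_apply, ← norm_le_zero_iff, ← hg t]
    exact norm_apply_le_truncNorm le_rfl g
  · obtain ⟨C, hC, h⟩ := LTI.boundedBelow hA hker (T + 1)
    refine ⟨C * (T + 1), by positivity, fun g => ?_⟩
    refine (truncNorm_le_sum T g).trans ((h g).trans ?_)
    rw [mul_assoc]
    refine mul_le_mul_of_nonneg_left ?_ hC
    refine (Finset.sum_le_card_nsmul _ _ (truncNorm n T ((1 - A) g)) fun t ht =>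
      norm_apply_le_truncNorm (Nat.lt_succ_iff.1 (Finset.mem_range.1 ht)) _).trans_eq ?_
    simp

theorem isUnit_and_eq_of_isStarShaped {ny nu : ℕ} {G : Seq2e nu →L[ℝ] Seq2e ny}
    {S : Set (Seq2e ny →L[ℝ] Seq2e nu)} (hG : G ∈ LTI nu ny) (hS : S ⊆ LTI ny nu)
    (hinert : IsInert G S) (hclosed : IsClosed[opTopology ny nu] S) (hhom : IsHomogeneous S) :
    (∀ K ∈ S, IsUnit (1 - G ∘L K)) ∧
      ∀ T : Set (Seq2e ny →L[ℝ] Seq2e nu), IsStarShaped T → hMap G '' S = T → T = S := by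
  have hinv : ∀ K ∈ S, _ := fun K hK => LTI.isUnit_one_sub (LTI.comp hG (hS hK)) (hinert K hK)
  refine ⟨fun K hK => (hinv K hK).1, ?_⟩
  rintro T hT rfl
  refine hMap_image_eq_self (p := truncNorm ny) (q := truncNorm nu) (LTI.isSeminormBounded hG)
    (fun K hK => (hinv K hK).1)
    (fun K hK => ((LTI.isSeminormBounded (hS hK)).comp (hinv K hK).2).neg)
    (fun K hK α => ⟨α • K, hhom K hK α, fun f => rfl⟩) ?_
    (fun Q hQ α hα => ⟨α • Q, hT Q hQ α hα, fun f => rfl⟩)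
  exact mem_of_isClosed_generateFrom_opNorm (N := opNorm) (fun f hf => truncNorm_le_one hf)
    (fun _ _ => rfl) hclosed

end Seq2e

/-! ### Continuous time: local `L₂` estimates and Volterra operators. -/

namespace L2e

variable {m n : ℕ}

theorem halfLine_restrict_Iic (T : ℝ) : halfLine.restrict (Iic T) = volume.restrict (Icc 0 T) := by
  rw [Measure.restrict_restrict measurableSet_Iic, Iic_inter_Ici]

theorem ae_halfLine_iff {P : ℝ → Prop} (T : ℝ) :
    (∀ᵐ t ∂halfLine, t ≤ (T : ℝ) → P t) ↔ ∀ᵐ t ∂volume.restrict (Icc 0 T), P t := by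
  rw [← halfLine_restrict_Iic, ae_restrict_iff' measurableSet_Iic]
  rfl

theorem memLp_restrict (f : L2e n) (T : ℝ≥0) : MemLp f 2 (volume.restrict (Icc 0 (T : ℝ))) := by
  rw [← halfLine_restrict_Iic]
  exact (memLp_indicator_iff_restrict measurableSet_Iic).1 (memLp_trunc f T)

theorem truncNorm_eq (T : ℝ≥0) (f : L2e n) :
    truncNorm n T f = (eLpNorm f 2 (volume.restrict (Icc 0 (T : ℝ)))).toReal := by
  rw [← halfLine_restrict_Iic, ← eLpNorm_indicator_eq_eLpNorm_restrict measurableSet_Iic]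
  exact Lp.norm_toLp _ (memLp_trunc f T)

theorem ofReal_truncNorm (T : ℝ≥0) (f : L2e n) :
    ENNReal.ofReal (truncNorm n T f) = eLpNorm f 2 (volume.restrict (Icc 0 (T : ℝ))) := by
  rw [truncNorm_eq, ENNReal.ofReal_toReal (memLp_restrict f T).eLpNorm_ne_top]

theorem truncNorm_le_of_ae_bound {T : ℝ≥0} {f : L2e n} {B : ℝ} (hB : 0 ≤ B)
    (h : ∀ᵐ t ∂halfLine, t ≤ (T : ℝ) → ‖f t‖ ≤ B) : truncNorm n T f ≤ √T * B := by
  rw [ae_halfLine_iff] at h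
  rw [← ENNReal.ofReal_le_ofReal_iff (by positivity), ofReal_truncNorm]
  refine (eLpNorm_le_of_ae_bound h).trans_eq ?_
  rw [ENNReal.ofReal_mul (Real.sqrt_nonneg _), Real.sqrt_eq_rpow,
    ← ENNReal.ofReal_rpow_of_nonneg T.coe_nonneg (by norm_num)]
  simp

theorem integrableOn_norm (f : L2e n) (T : ℝ≥0) :
    IntegrableOn (fun t => ‖f t‖) (Icc 0 (T : ℝ)) :=
  ((memLp_restrict f T).integrable (by norm_num)).norm

theorem intervalIntegrable_norm (f : L2e n) {t : ℝ} (ht : 0 ≤ t) :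
    IntervalIntegrable (fun t => ‖f t‖) volume 0 t := by
  rw [intervalIntegrable_iff_integrableOn_Icc_of_le ht]
  exact integrableOn_norm f ⟨t, ht⟩

theorem integral_norm_le_of_memLp {E : Type*} [NormedAddCommGroup E] {g : ℝ → E} {T : ℝ≥0}
    (hg : MemLp g 2 (volume.restrict (Icc 0 (T : ℝ)))) :
    ∫ t in (0 : ℝ)..T, ‖g t‖ ≤ √T * (eLpNorm g 2 (volume.restrict (Icc 0 (T : ℝ)))).toReal := by
  rw [intervalIntegral.integral_of_le T.coe_nonneg, ← integral_Icc_eq_integral_Ioc,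
    integral_norm_eq_lintegral_enorm hg.1, ← eLpNorm_one_eq_lintegral_enorm]
  have h := eLpNorm_le_eLpNorm_mul_rpow_measure_univ (p := 1) (q := 2) (by norm_num) hg.1
  refine ENNReal.toReal_le_of_le_ofReal (by positivity) (h.trans_eq ?_)
  rw [mul_comm, ENNReal.ofReal_mul (Real.sqrt_nonneg _), Real.sqrt_eq_rpow,
    ← ENNReal.ofReal_rpow_of_nonneg T.coe_nonneg (by norm_num), ENNReal.ofReal_toReal hg.eLpNorm_ne_top]
  norm_num

theorem integral_norm_le (f : L2e n) (T : ℝ≥0) :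
    ∫ t in (0 : ℝ)..T, ‖f t‖ ≤ √T * truncNorm n T f := by
  rw [truncNorm_eq]
  exact integral_norm_le_of_memLp (memLp_restrict f T)

theorem eq_zero_of_truncNorm {f : L2e n} (h : ∀ T, truncNorm n T f = 0) : f = 0 := by
  have h1 : ∀ N : ℕ, ∀ᵐ t ∂halfLine, t ≤ (N : ℝ) → f t = 0 := by
    intro N
    have h2 := ofReal_truncNorm (N : ℝ≥0) f
    rw [h, ENNReal.ofReal_zero, eq_comm,
      eLpNorm_eq_zero_iff (memLp_restrict f N).1 (by norm_num)] at h2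
    exact (ae_halfLine_iff _).2 h2
  apply Subtype.ext
  refine AEEqFun.ext ?_
  filter_upwards [ae_all_iff.2 h1, AEEqFun.coeFn_zero (μ := halfLine) (α := ℝ)
      (β := EuclideanSpace ℝ (Fin n))] with t ht h0
  obtain ⟨N, hN⟩ := exists_nat_ge t
  exact (ht N hN).trans h0.symm

theorem coeFn_trunc (T : ℝ≥0) (f : L2e n) :
    ∀ᵐ t ∂halfLine, trunc T f t = (Iic (T : ℝ)).indicator f t :=
  AEEqFun.coeFn_mk _ _

theorem truncNorm_trunc_le (T T' : ℝ≥0) (f : L2e n) :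
    truncNorm n T' (trunc T f) ≤ truncNorm n T f := by
  have h1 := Lp.norm_toLp _ (memLp_trunc (trunc T f) T')
  have h2 := Lp.norm_toLp _ (memLp_trunc f T)
  refine h1.trans_le (le_trans ?_ h2.ge)
  refine ENNReal.toReal_mono (memLp_trunc f T).eLpNorm_ne_top (eLpNorm_mono_ae ?_)
  filter_upwards [coeFn_trunc T f] with t ht
  refine (norm_indicator_le_norm_self _ _).trans_eq ?_
  rw [ht]

theorem truncNorm_trunc (T : ℝ≥0) (f : L2e n) :
    truncNorm n T (trunc T f) = truncNorm n T f := by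
  rw [truncNorm_eq, truncNorm_eq]
  congr 1
  refine eLpNorm_congr_ae ((ae_halfLine_iff _).1 ?_)
  filter_upwards [coeFn_trunc T f] with t ht hT
  rw [ht]
  exact indicator_of_mem (M := EuclideanSpace ℝ (Fin n)) (mem_Iic.2 hT) _

theorem truncNorm_le_one {f : L2e n} (hf : eLpNorm f 2 halfLine ≤ 1) (T : ℝ≥0) :
    truncNorm n T f ≤ 1 := by
  rw [← ENNReal.ofReal_le_one, ofReal_truncNorm, ← halfLine_restrict_Iic]
  exact (eLpNorm_restrict_le _ _ _ _).trans hf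

theorem LTI.isSeminormBounded {A : L2e m →L[ℝ] L2e n} (hA : A ∈ LTI m n) :
    IsSeminormBounded (truncNorm m) (truncNorm n) A :=
  isSeminormBounded_of_truncation withSeminorms_truncNorm withSeminorms_truncNorm trunc
    truncNorm_trunc_le fun T f => by rw [← truncNorm_trunc, hA.1, truncNorm_trunc]

theorem coeFn_sub (f g : L2e n) : ∀ᵐ t ∂halfLine, (f - g) t = f t - g t :=
  AEEqFun.coeFn_sub f.1 g.1

theorem coeFn_sum (u : ℕ → L2e n) (N : ℕ) :
    ∀ᵐ t ∂halfLine, (∑ k ∈ Finset.range N, u k) t = ∑ k ∈ Finset.range N, u k t := by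
  induction N with
  | zero =>
    filter_upwards [AEEqFun.coeFn_zero (μ := halfLine) (α := ℝ)
      (β := EuclideanSpace ℝ (Fin n))] with t ht
    simp only [Finset.range_zero, Finset.sum_empty]
    exact ht
  | succ N ih =>
    have h : ∀ᵐ t ∂halfLine, (∑ k ∈ Finset.range N, u k + u N) t =
        (∑ k ∈ Finset.range N, u k) t + u N t := AEEqFun.coeFn_add _ _
    filter_upwards [ih, h] with t h1 h2
    rw [Finset.sum_range_succ, Finset.sum_range_succ, h2, h1]

/-- A series of signals that converges uniformly on bounded intervals converges in `L2e`. -/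
theorem exists_tendsto_truncNorm_sub_sum {u : ℕ → L2e n}
    (hu : ∀ T : ℝ≥0, ∃ b : ℕ → ℝ, Summable b ∧ ∀ k, ∀ᵐ t ∂halfLine, t ≤ (T : ℝ) → ‖u k t‖ ≤ b k) :
    ∃ g : L2e n, ∀ T, Filter.Tendsto
      (fun N => truncNorm n T (g - ∑ k ∈ Finset.range N, u k)) Filter.atTop (𝓝 0) := by
  -- The limit is the pointwise sum, defined almost everywhere because integer horizons exhaust the
  -- half-line.
  have hsum : ∀ᵐ t ∂halfLine, Summable fun k => u k t := by
    have h : ∀ N : ℕ, ∀ᵐ t ∂halfLine, t ≤ (N : ℝ) → Summable fun k => u k t := by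
      intro N
      obtain ⟨b, hb, h⟩ := hu N
      filter_upwards [ae_all_iff.2 h] with t ht hN
      exact Summable.of_norm_bounded hb fun k => ht k hN
    filter_upwards [ae_all_iff.2 h] with t ht
    obtain ⟨N, hN⟩ := exists_nat_ge t
    exact ht N hN
  have hmeas : AEStronglyMeasurable (fun t => ∑' k, u k t) halfLine := by
    refine aestronglyMeasurable_of_tendsto_ae Filter.atTop
      (f := fun N t => ∑ k ∈ Finset.range N, u k t) (fun N => ?_) ?_
    · exact Finset.aestronglyMeasurable_fun_sum _ fun k _ => (u k).1.aestronglyMeasurable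
    · filter_upwards [hsum] with t ht
      exact ht.hasSum.tendsto_sum_nat
  have hcoe := AEEqFun.coeFn_mk _ hmeas
  have hLp : AEEqFun.mk _ hmeas ∈ L2eSubmodule n := by
    intro T hT
    obtain ⟨b, hb, h⟩ := hu ⟨T, hT⟩
    rw [memLp_indicator_iff_restrict measurableSet_Iic, halfLine_restrict_Iic]
    refine MemLp.of_bound ?_ (∑' k, b k) ((ae_halfLine_iff T).1 ?_)
    · rw [← halfLine_restrict_Iic]
      exact (AEEqFun.aestronglyMeasurable _).restrict
    · filter_upwards [hcoe, ae_all_iff.2 h] with t ht hk htT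
      rw [ht]
      exact tsum_of_norm_bounded hb.hasSum fun k => hk k htT
  refine ⟨⟨_, hLp⟩, fun T => ?_⟩
  set g : L2e n := ⟨_, hLp⟩
  obtain ⟨b, hb, h⟩ := hu T
  have hbound : ∀ N, truncNorm n T (g - ∑ k ∈ Finset.range N, u k) ≤
      √T * |∑' k, b (k + N)| := by
    intro N
    refine truncNorm_le_of_ae_bound (abs_nonneg _) ?_
    filter_upwards [hcoe, ae_all_iff.2 h, hsum, coeFn_sub g (∑ k ∈ Finset.range N, u k),
      coeFn_sum u N] with t h1 h2 h3 h4 h5 htT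
    have h6 : g t = ∑' k, u k t := h1
    rw [h4, h5, h6, ← h3.sum_add_tsum_nat_add N, add_sub_cancel_left]
    refine le_trans ?_ (le_abs_self _)
    exact tsum_of_norm_bounded ((summable_nat_add_iff N).2 hb).hasSum fun k => h2 (k + N) htT
  refine squeeze_zero (fun N => apply_nonneg _ _) hbound ?_
  simpa using (tendsto_sum_nat_add b).abs.const_mul √(T : ℝ)

/-- Operators that are dominated by integration, locally uniformly in time. -/
def IsVolterra (X : L2e n →L[ℝ] L2e n) : Prop :=
  ∀ T : ℝ≥0, ∃ C : ℝ, 0 ≤ C ∧ ∀ f : L2e n, ∀ᵐ t ∂halfLine, t ≤ (T : ℝ) →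
    ‖X f t‖ ≤ C * ∫ s in (0 : ℝ)..t, ‖f s‖

theorem MemLinfE.exists_bound {a : ℝ → ℝ} (ha : MemLinfE a) (T : ℝ≥0) :
    ∃ M : ℝ, 0 ≤ M ∧ ∀ᵐ r ∂volume, r ∈ Icc 0 (T : ℝ) → |a r| ≤ M := by
  have h := (memLp_indicator_iff_restrict measurableSet_Iic).1 (ha T)
  rw [halfLine_restrict_Iic] at h
  refine ⟨(eLpNorm a ∞ (volume.restrict (Icc 0 (T : ℝ)))).toReal, ENNReal.toReal_nonneg, ?_⟩
  rw [← ae_restrict_iff' measurableSet_Icc]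
  have h1 := ae_le_eLpNormEssSup (f := a) (μ := volume.restrict (Icc 0 (T : ℝ)))
  filter_upwards [h1] with r hr
  rw [← eLpNorm_exponent_top] at hr
  have := ENNReal.toReal_mono h.eLpNorm_ne_top hr
  simpa using this

theorem norm_integral_convolution_le {a : ℝ → ℝ} {M T t : ℝ}
    (ha : ∀ᵐ r ∂volume, r ∈ Icc 0 T → |a r| ≤ M) (ht0 : 0 ≤ t) (htT : t ≤ T)
    (f : L2e n) (j : Fin n) :
    |∫ s in (0 : ℝ)..t, a (t - s) * f s j| ≤ M * ∫ s in (0 : ℝ)..t, ‖f s‖ := by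
  rw [← intervalIntegral.integral_const_mul, ← Real.norm_eq_abs]
  refine intervalIntegral.norm_integral_le_of_norm_le ht0 ?_
    ((intervalIntegrable_norm f ht0).const_mul M)
  -- The exceptional null set for `a` is pulled back along the measure-preserving map `s ↦ t - s`.
  have h := (Measure.measurePreserving_sub_left volume t).quasiMeasurePreserving.ae ha
  filter_upwards [h] with s hs hst
  rw [norm_mul]
  have h1 : |a (t - s)| ≤ M := hs ⟨by linarith [hst.2], by linarith [hst.1]⟩
  exact mul_le_mul h1 (PiLp.norm_apply_le (f s) j) (norm_nonneg _) ((abs_nonneg _).trans h1)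

theorem IsImpulseResponse.isVolterra {X : L2e n →L[ℝ] L2e n} {a : ℝ → Matrix (Fin n) (Fin n) ℝ}
    (hX : IsImpulseResponse X a) (ha : ∀ i j, MemLinfE fun t => a t i j) : IsVolterra X := by
  intro T
  choose M hM0 hM using fun i j => MemLinfE.exists_bound (ha i j) T
  refine ⟨∑ i, ∑ j, M i j, Finset.sum_nonneg fun i _ => Finset.sum_nonneg fun j _ => hM0 i j,
    fun f => ?_⟩
  filter_upwards [hX f, ae_restrict_mem measurableSet_Ici] with t ht ht0 htT
  have h1 : ‖X f t‖ ≤ ∑ i, ‖X f t i‖ := by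
    rw [← sq_le_sq₀ (norm_nonneg _) (Finset.sum_nonneg fun _ _ => norm_nonneg _),
      EuclideanSpace.norm_sq_eq]
    exact Finset.sum_sq_le_sq_sum_of_nonneg fun _ _ => norm_nonneg _
  refine h1.trans ?_
  rw [Finset.sum_mul]
  refine Finset.sum_le_sum fun i _ => ?_
  rw [ht i, Finset.sum_mul]
  refine (norm_sum_le _ _).trans (Finset.sum_le_sum fun j _ => ?_)
  exact norm_integral_convolution_le (hM i j) ht0 htT f j

/-! ### Neumann series of a Volterra operator. -/

namespace IsVolterra

variable {X : L2e n →L[ℝ] L2e n}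

/-- The first application of `X` turns an `L₂` signal into a locally bounded one; each later
application integrates `s ^ k / k!` once more. Hence the power is `k + 1` against `t ^ k / k!`. -/
theorem ae_norm_iterate_le {C : ℝ} (hC : 0 ≤ C) {T : ℝ≥0}
    (h : ∀ f : L2e n, ∀ᵐ t ∂halfLine, t ≤ (T : ℝ) → ‖X f t‖ ≤ C * ∫ s in (0 : ℝ)..t, ‖f s‖)
    (f : L2e n) (k : ℕ) :
    ∀ᵐ t ∂halfLine, t ≤ (T : ℝ) → ‖(X ^ (k + 1)) f t‖ ≤
      (C ^ (k + 1) * ∫ s in (0 : ℝ)..T, ‖f s‖) * (t ^ k / k.factorial) := by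
  induction k with
  | zero =>
    filter_upwards [h f, ae_restrict_mem measurableSet_Ici] with t ht ht0 htT
    rw [zero_add, pow_one, pow_one, pow_zero, Nat.factorial_zero, Nat.cast_one, div_one, mul_one]
    refine (ht htT).trans (mul_le_mul_of_nonneg_left ?_ hC)
    exact intervalIntegral.integral_mono_interval le_rfl ht0 htT
      (Filter.Eventually.of_forall fun _ => norm_nonneg _) (intervalIntegrable_norm f T.coe_nonneg)
  | succ k ih =>
    filter_upwards [h ((X ^ (k + 1)) f), ae_restrict_mem measurableSet_Ici] with t ht ht0 htT
    rw [pow_succ' X (k + 1)]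
    refine (ht htT).trans ?_
    set F := ∫ s in (0 : ℝ)..T, ‖f s‖
    have hle : ∫ s in (0 : ℝ)..t, ‖(X ^ (k + 1)) f s‖ ≤
        ∫ s in (0 : ℝ)..t, (C ^ (k + 1) * F) * (s ^ k / k.factorial) := by
      refine intervalIntegral.integral_mono_ae_restrict ht0 (intervalIntegrable_norm _ ht0)
        (Continuous.intervalIntegrable (by fun_prop) _ _) ((ae_halfLine_iff t).1 ?_)
      filter_upwards [ih] with s hs hst
      exact hs (hst.trans htT)
    refine (mul_le_mul_of_nonneg_left hle hC).trans_eq ?_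
    rw [intervalIntegral.integral_const_mul, intervalIntegral.integral_div, integral_pow,
      Nat.factorial_succ]
    push_cast
    field_simp
    ring

theorem exists_summable_bound (hX : IsVolterra X) (T : ℝ≥0) :
    ∃ c : ℕ → ℝ, Summable c ∧ ∀ (f : L2e n) (k : ℕ),
      ∀ᵐ t ∂halfLine, t ≤ (T : ℝ) → ‖(X ^ (k + 1)) f t‖ ≤ c k * truncNorm n T f := by
  obtain ⟨C, hC, h⟩ := hX T
  refine ⟨fun k => C * √T * ((C * T) ^ k / k.factorial),
    (Real.summable_pow_div_factorial _).mul_left _, fun f k => ?_⟩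
  filter_upwards [ae_norm_iterate_le hC h f k, ae_restrict_mem measurableSet_Ici] with t ht ht0 htT
  refine (ht htT).trans ?_
  have ht0' : (0 : ℝ) ≤ t := ht0
  calc (C ^ (k + 1) * ∫ s in (0 : ℝ)..T, ‖f s‖) * (t ^ k / k.factorial)
      ≤ (C ^ (k + 1) * (√T * truncNorm n T f)) * ((T : ℝ) ^ k / k.factorial) := by
        gcongr
        exact integral_norm_le f T
    _ = C * √T * ((C * T) ^ k / k.factorial) * truncNorm n T f := by
        rw [mul_pow, pow_succ]; ring

theorem exists_summable_truncNorm_bound (hX : IsVolterra X) (T : ℝ≥0) :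
    ∃ c : ℕ → ℝ, Summable c ∧ ∀ (f : L2e n) (k : ℕ),
      truncNorm n T ((X ^ k) f) ≤ c k * truncNorm n T f := by
  obtain ⟨c, hc, h⟩ := hX.exists_summable_bound T
  -- The index `0` is separate: `X ^ 0` is the identity and has no pointwise bound by the `L₂` norm,
  -- only the seminorm constant `1`.
  refine ⟨fun k => Nat.casesOn k 1 fun k => √T * |c k|,
    (summable_nat_add_iff 1).1 (hc.abs.mul_left _), fun f k => ?_⟩
  cases k with
  | zero => simp
  | succ k =>
    have := truncNorm_le_of_ae_bound (T := T) (f := (X ^ (k + 1)) f)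
      (B := |c k| * truncNorm n T f) (mul_nonneg (abs_nonneg _) (apply_nonneg _ _)) (by
        filter_upwards [h f k] with t ht htT
        exact (ht htT).trans
          (mul_le_mul_of_nonneg_right (le_abs_self _) (apply_nonneg _ _)))
    rwa [← mul_assoc] at this

theorem apply_sum_range (X : L2e n →L[ℝ] L2e n) (f : L2e n) (N : ℕ) :
    (1 - X) (∑ k ∈ Finset.range N, (X ^ k) f) = f - (X ^ N) f := by
  have h := congrArg (fun A : L2e n →L[ℝ] L2e n => A f) (mul_neg_geom_sum X N)
  have h1 : (1 - X) ((∑ k ∈ Finset.range N, X ^ k) f) = f - (X ^ N) f := h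
  rw [← h1]
  congr 1
  exact (sum_apply _ _ _).symm

theorem sum_range_apply (X : L2e n →L[ℝ] L2e n) (g : L2e n) (N : ℕ) :
    ∑ k ∈ Finset.range N, (X ^ k) ((1 - X) g) = g - (X ^ N) g := by
  have h := congrArg (fun A : L2e n →L[ℝ] L2e n => A g) (geom_sum_mul_neg X N)
  have h1 : (∑ k ∈ Finset.range N, X ^ k) ((1 - X) g) = g - (X ^ N) g := h
  rw [← h1]
  exact (sum_apply _ _ _).symm

theorem surjective_one_sub (hX : IsVolterra X) :
    Function.Surjective (1 - X : L2e n →L[ℝ] L2e n) := by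
  intro f
  -- The Neumann series starts at `X f`, since `f` itself need not be locally bounded; `f` is added
  -- back afterwards.
  obtain ⟨g, hg⟩ := exists_tendsto_truncNorm_sub_sum (u := fun k => (X ^ (k + 1)) f) fun T => by
    obtain ⟨c, hc, h⟩ := hX.exists_summable_bound T
    exact ⟨fun k => c k * truncNorm n T f, hc.mul_right _, fun k => h f k⟩
  refine ⟨f + g, sub_eq_zero.1 (eq_zero_of_truncNorm fun T => ?_)⟩
  obtain ⟨c, hc, h⟩ := hX.exists_summable_truncNorm_bound T
  -- The left side does not depend on `N`, while both terms on the right tend to zero.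
  have hdecomp : ∀ N, (1 - X) (f + g) - f =
      (1 - X) (g - ∑ k ∈ Finset.range N, (X ^ (k + 1)) f) - (X ^ (N + 1)) f := by
    intro N
    have h1 := apply_sum_range X f (N + 1)
    rw [Finset.sum_range_succ', pow_zero, map_add] at h1
    have h2 : (1 - X) ((1 : L2e n →L[ℝ] L2e n) f) = (1 - X) f := rfl
    rw [h2] at h1
    rw [map_add, map_sub, eq_sub_of_add_eq h1]
    abel
  have hbound : ∀ N, truncNorm n T ((1 - X) (f + g) - f) ≤
      (1 + c 1) * truncNorm n T (g - ∑ k ∈ Finset.range N, (X ^ (k + 1)) f) +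
        c (N + 1) * truncNorm n T f := by
    intro N
    rw [hdecomp N]
    set e := g - ∑ k ∈ Finset.range N, (X ^ (k + 1)) f
    have h1 : truncNorm n T ((1 - X) e) ≤ truncNorm n T e + truncNorm n T (X e) :=
      map_sub_le_add (truncNorm n T) e (X e)
    have h2 : truncNorm n T (X e) ≤ c 1 * truncNorm n T e := by simpa using h e 1
    have h3 := h f (N + 1)
    have h4 := map_sub_le_add (truncNorm n T) ((1 - X) e) ((X ^ (N + 1)) f)
    linarith
  have hlim := ((hg T).const_mul (1 + c 1)).add
    (((Filter.tendsto_add_atTop_iff_nat 1).2 hc.tendsto_atTop_zero).mul_const (truncNorm n T f))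
  rw [mul_zero, zero_mul, add_zero] at hlim
  exact le_antisymm (ge_of_tendsto' hlim hbound) (apply_nonneg _ _)

theorem boundedBelow (hX : IsVolterra X) (T : ℝ≥0) :
    ∃ C : ℝ, 0 ≤ C ∧ ∀ g, truncNorm n T g ≤ C * truncNorm n T ((1 - X) g) := by
  obtain ⟨c, hc, h⟩ := hX.exists_summable_truncNorm_bound T
  obtain ⟨N, hN⟩ := (hc.tendsto_atTop_zero.eventually_lt_const (u := 1 / 2) (by norm_num)).exists
  -- In `g = ∑_{k<N} X^k (1 - X) g + X^N g` the last term is at most half of `g` in the seminorm;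
  -- absorbing it gives the factor `2`.
  refine ⟨2 * ∑ k ∈ Finset.range N, |c k|, by positivity, fun g => ?_⟩
  have h1 : g = ∑ k ∈ Finset.range N, (X ^ k) ((1 - X) g) + (X ^ N) g := by
    rw [sum_range_apply, sub_add_cancel]
  have h2 := (congrArg (truncNorm n T) h1).le.trans (map_add_le_add _ _ _)
  have h3 : truncNorm n T (∑ k ∈ Finset.range N, (X ^ k) ((1 - X) g)) ≤
      (∑ k ∈ Finset.range N, |c k|) * truncNorm n T ((1 - X) g) := by
    rw [Finset.sum_mul]
    refine (Finset.le_sum_of_subadditive (truncNorm n T) (map_zero _).le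
      (map_add_le_add _) _ _).trans (Finset.sum_le_sum fun k _ => ?_)
    exact (h _ k).trans (mul_le_mul_of_nonneg_right (le_abs_self _) (apply_nonneg _ _))
  have h4 := h g N
  have h5 : 0 ≤ truncNorm n T g := apply_nonneg _ _
  nlinarith

/-- Invertibility of `1 - X`, with a bounded inverse, for a Volterra operator `X`. -/
theorem isUnit_one_sub (hX : IsVolterra X) :
    IsUnit (1 - X) ∧ IsSeminormBounded (truncNorm n) (truncNorm n) (Ring.inverse (1 - X)) :=
  isUnit_of_seminorm_boundedBelow withSeminorms_truncNorm (fun _ hg => eq_zero_of_truncNorm hg)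
    hX.surjective_one_sub hX.boundedBelow

end IsVolterra

theorem isUnit_and_eq_of_isStarShaped {ny nu : ℕ} {G : L2e nu →L[ℝ] L2e ny}
    {S : Set (L2e ny →L[ℝ] L2e nu)} (hG : G ∈ LTI nu ny) (hS : S ⊆ LTI ny nu)
    (hinert : IsInert G S) (hclosed : IsClosed[opTopology ny nu] S) (hhom : IsHomogeneous S) :
    (∀ K ∈ S, IsUnit (1 - G ∘L K)) ∧
      ∀ T : Set (L2e ny →L[ℝ] L2e nu), IsStarShaped T → hMap G '' S = T → T = S := by
  have hinv : ∀ K ∈ S, IsUnit (1 - G ∘L K) ∧ IsSeminormBounded (truncNorm ny) (truncNorm ny)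
      (Ring.inverse (1 - G ∘L K)) := by
    intro K hK
    obtain ⟨a, ha, hGK⟩ := hinert K hK
    exact (IsImpulseResponse.isVolterra hGK ha).isUnit_one_sub
  refine ⟨fun K hK => (hinv K hK).1, ?_⟩
  rintro T hT rfl
  refine hMap_image_eq_self (p := truncNorm ny) (q := truncNorm nu) (LTI.isSeminormBounded hG)
    (fun K hK => (hinv K hK).1)
    (fun K hK => ((LTI.isSeminormBounded (hS hK)).comp (hinv K hK).2).neg)
    (fun K hK α => ⟨α • K, hhom K hK α, fun f => rfl⟩) ?_
    (fun Q hQ α hα => ⟨α • Q, hT Q hQ α hα, fun f => rfl⟩)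
  exact mem_of_isClosed_generateFrom_opNorm (N := opNorm) (fun f hf => truncNorm_le_one hf)
    (fun _ _ => rfl) hclosed

end L2e

theorem theorem4 (ny nu : ℕ) :
    (∀ (G : L2e nu →L[ℝ] L2e ny) (S : Set (L2e ny →L[ℝ] L2e nu)),
      G ∈ L2e.LTI nu ny → S ⊆ L2e.LTI ny nu → L2e.IsInert G S →
      IsClosed[L2e.opTopology ny nu] S → IsHomogeneous S →
      (∀ K ∈ S, IsUnit (1 - G ∘L K)) ∧
      ∀ T : Set (L2e ny →L[ℝ] L2e nu), IsStarShaped T → hMap G '' S = T → T = S) ∧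
    (∀ (G : Seq2e nu →L[ℝ] Seq2e ny) (S : Set (Seq2e ny →L[ℝ] Seq2e nu)),
      G ∈ Seq2e.LTI nu ny → S ⊆ Seq2e.LTI ny nu → Seq2e.IsInert G S →
      IsClosed[Seq2e.opTopology ny nu] S → IsHomogeneous S →
      (∀ K ∈ S, IsUnit (1 - G ∘L K)) ∧
      ∀ T : Set (Seq2e ny →L[ℝ] Seq2e nu), IsStarShaped T → hMap G '' S = T → T = S) :=
  ⟨fun _ _ hG hS hinert hclosed hhom =>
      L2e.isUnit_and_eq_of_isStarShaped hG hS hinert hclosed hhom,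
    fun _ _ hG hS hinert hclosed hhom =>
      Seq2e.isUnit_and_eq_of_isStarShaped hG hS hinert hclosed hhom⟩
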